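/- **Setting.** Let $\mathscr X=[0,1]$. A process is a probability measure $\mu$ on $\mathscr X^{\mathbb N}$ with the product $\sigma$-algebra, with coordinate variables $\mathbf X=(X_1,X_2,\dots)$; it is stationary if $\mu$ is invariant under the left shift. For sub-$\sigma$-algebras $\mathfrak U,\mathfrak V$ let $$\beta(\mathfrak U,\mathfrak V)=\sup_{W\in\mathfrak U\otimes\mathfrak V}|\mu_\otimes(W)-(\mu_{\mathfrak U}\times\mu_{\mathfrak V})(W)|,$$ where $\mu_\otimes$ is the image of $\mu$ under $\omega\mapsto(\omega,\omega)$ and $\mu_{\mathfrak U},\mu_{\mathfrak V}$ are the restrictions of $\mu$ to $\mathfrak U,\mathfrak V$. For $m\ge 1$ let $$\beta(m)=\sup_{j\ge1}\beta\big(\sigma(X_t:1\le t\le j),\,\sigma(X_t:t\ge j+m)\big).$$ Let $\mathscr C^\beta$ be the class of stationary processes with $\lim_{m\to\infty}\beta(m)=0$ and $\sum_{m\ge1}\beta(m)<\infty$. For $\gamma:\mathbb N\to[0,1]$ let $\mathscr R^\beta_\gamma$ be the class of processes with $\beta(m)\le\gamma(m)$ for all $m\ge1$. **Estimator.** Let $\Delta_{k,\ell}$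 be the partition of $[0,1]^k$ into the $2^{k\ell}$ dyadic cubes of side $2^{-\ell}$, that is, products of intervals $[i2^{-\ell},(i+1)2^{-\ell})$, $0\le i<2^\ell$, the last of which ($i=2^\ell-1$) also contains the point $1$. For $N\ge1$ and $B\subseteq[0,1]^k$ put $$\mu_N(\mathbf X,B)=\frac1N\sum_{i=0}^{N-1}\chi_B(X_{ik+1},\dots,X_{(i+1)k}).$$ For $1\le j\le n-m$, $j'=n-m-j+1$, $A\subseteq[0,1]^j$ and $B\subseteq[0,1]^{j'}$ put $$\gamma^{m,j}_{N,n}(\mathbf X,A,B)=\frac1N\sum_{i=0}^{N-1}\chi_A(X_{in+1},\dots,X_{in+j})\,\chi_B(X_{in+j+m},\dots,X_{(i+1)n}),$$ and let $$\widehat\beta^{\,\ell}_{N,n}(\mathbf X,m)=\max_{1\le j\le n-m}\frac12\sum_{A\in\Delta_{j,\ell}}\sum_{B\in\Delta_{j',\ell}}\big|\gamma^{m,j}_{N,n}(\mathbf X,A,B)-\mu_N(\mathbf X,A)\mu_N(\mathbf X,B)\big|,$$ with value $0$ if $m\ge n$. **Test.** Let $(M_t),(\ell_t),(n_t)$ be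 non-decreasing unbounded sequences of positive integers, $(\delta_t)$ a sequence of positive reals with $\sum_t\delta_t<\infty$, and $(\epsilon_t)$ a sequence of positive reals with $\epsilon_t\to0$. With $\widetilde C_{m,\ell,k}=m\,2^{2^{2k\ell+1}+2^{m\ell+1}+2}$ put $$\widetilde\tau_t(m)=\left\lceil\frac{\widetilde C_{m,\ell_t,n_t}}{m\,\epsilon_t^2\,\delta_t}\right\rceil,\qquad \widehat\beta_t(\mathbf X,m)=\widehat\beta^{\,\ell_t}_{\widetilde\tau_t(m),n_t}(\mathbf X,m).$$ For $\gamma:\mathbb N\to[0,1]$ let $\widetilde g_t(\mathbf X)=+1$ if $\widehat\beta_t(\mathbf X,m)\le\gamma(m)+\epsilon_t$ for all $m\in\{1,\dots,M_t\}$, and $\widetilde g_t(\mathbf X)=-1$ otherwise. **Theorem.** For every $\gamma:\mathbb N\to[0,1]$ the sequence $(\widetilde g_t)$ is a strongly consistent goodness-of-fit test for the rate function $\gamma$ on $\mathscr C^\beta$: each $\widetilde g_t$ is measurable with respect to $\sigma(X_1,\dots,X_{N_t})$, where $N_t=n_t\max_{1\le m\le M_t}\widetilde\tau_t(m)$, and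 for every $\mu\in\mathscr C^\beta$, $\mu$-almost surely, $$\lim_{t\to\infty}\widetilde g_t(\mathbf X)=\begin{cases}+1&\text{if }\mu\in\mathscr C^\beta\cap\mathscr R^\beta_\gamma,\\-1&\text{if }\mu\in\mathscr C^\beta\setminus\mathscr R^\beta_\gamma.\end{cases}$$ -/

import Mathlib

open MeasureTheory Filter Topology

noncomputable section

/-- The space of `[0,1]`-valued sequences `(X_1, X_2, …)`, with the product (cylinder) σ-algebra.
Sequences are stored from index `0`: the coordinate `X_{s+1}` is `ω s`. A stochastic process is a
probability measure on this space. -/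
abbrev SeqSpace : Type := ℕ → unitInterval

/-- The left shift. -/
def shiftMap (ω : SeqSpace) : SeqSpace := fun s => ω (s + 1)

/-! ### β-dependence and β-mixing coefficients -/

/-- The σ-algebra generated by the coordinates `ω s`, `s ∈ S`. -/
@[reducible] def coordSigma (S : Set ℕ) : MeasurableSpace SeqSpace :=
  ⨆ s ∈ S, MeasurableSpace.comap (fun ω : SeqSpace => ω s) inferInstance

theorem coordSigma_le (S : Set ℕ) : coordSigma S ≤ (inferInstance : MeasurableSpace SeqSpace) :=
  iSup₂_le fun s _ => (measurable_pi_apply s).comap_le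

/-- `β(U, V) = sup |μ_⊗(W) - (μ_U × μ_V)(W)|` over all `W` in the product σ-algebra `U ⊗ V`, where
`μ_⊗` is the image of `μ` under the diagonal map and `μ_U`, `μ_V` are the restrictions of `μ` to
the sub-σ-algebras `U` and `V`. -/
def betaDep {Ω : Type*} [mΩ : MeasurableSpace Ω] (μ : Measure Ω) (U V : MeasurableSpace Ω)
    (hU : U ≤ mΩ) (hV : V ≤ mΩ) : ℝ :=
  ⨆ W : {W : Set (Ω × Ω) // MeasurableSet[U.prod V] W},
    |(@Measure.map Ω (Ω × Ω) mΩ (U.prod V) (fun ω => (ω, ω)) μ W.1).toReal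
      - (@Measure.prod Ω Ω U V (μ.trim hU) (μ.trim hV) W.1).toReal|

/-- `β(m) = sup_{j ≥ 1} β(σ(X_t : 1 ≤ t ≤ j), σ(X_t : t ≥ j + m))`, for `m ≥ 1`. -/
def betaCoeff (μ : Measure SeqSpace) (m : ℕ) : ℝ :=
  ⨆ j : ℕ+, betaDep μ (coordSigma {s | s + 1 ≤ (j : ℕ)}) (coordSigma {s | (j : ℕ) + m ≤ s + 1})
    (coordSigma_le _) (coordSigma_le _)

/-- The class of stationary β-mixing processes with summable β-mixing coefficients
(the coefficients are `β(1), β(2), …`). -/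
structure InClassBeta (μ : Measure SeqSpace) : Prop where
  prob : IsProbabilityMeasure μ
  stationary : MeasurePreserving shiftMap μ μ
  mixing : Tendsto (betaCoeff μ) atTop (𝓝 0)
  summable : Summable fun i : ℕ => betaCoeff μ (i + 1)

/-- `γ` is a β-mixing rate function for `μ`. -/
def IsBetaRate (γ : ℕ → ℝ) (μ : Measure SeqSpace) : Prop :=
  ∀ m : ℕ, 1 ≤ m → betaCoeff μ m ≤ γ m

/-! ### The estimator -/

/-- The dyadic interval `[i / 2^ℓ, (i + 1) / 2^ℓ)`; the last one, `i = 2^ℓ - 1`, also contains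
the point `1`, so that these intervals partition `[0,1]`. -/
def dyadicCell (ℓ : ℕ) (i : Fin (2 ^ ℓ)) : Set unitInterval :=
  {x | ((i : ℕ) : ℝ) / 2 ^ ℓ ≤ (x : ℝ) ∧
    ((x : ℝ) < (((i : ℕ) : ℝ) + 1) / 2 ^ ℓ ∨ ((i : ℕ) + 1 = 2 ^ ℓ ∧ (x : ℝ) = 1))}

/-- The dyadic cube of side length `2^{-ℓ}` in `[0,1]^k` with index `a`. Distinct indices give
disjoint nonempty cubes, so summing over all `a` is summing over all dyadic cubes. -/
def dyadicCube (k ℓ : ℕ) (a : Fin k → Fin (2 ^ ℓ)) : Set (Fin k → unitInterval) :=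
  {x | ∀ p, x p ∈ dyadicCell ℓ (a p)}

/-- The observations `(X_{s+1}, …, X_{s+k})`. -/
def block (ω : SeqSpace) (s k : ℕ) : Fin k → unitInterval := fun p => ω (s + p)

/-- Empirical measure from `N` blocks of length `k`:
`μ_N(X, B) = (1/N) ∑_{i=0}^{N-1} χ_B(X_{ik+1}, …, X_{(i+1)k})`. -/
def empMeasure (N : ℕ) (ω : SeqSpace) {k : ℕ} (B : Set (Fin k → unitInterval)) : ℝ :=
  (1 / (N : ℝ)) * ∑ i ∈ Finset.range N, B.indicator (fun _ => (1 : ℝ)) (block ω (i * k) k)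

/-- Empirical joint measure from `N` blocks of length `n`:
`(1/N) ∑_{i=0}^{N-1} χ_A(X_{in+1}, …, X_{in+j}) χ_B(X_{in+j+m}, …, X_{(i+1)n})`. -/
def empJoint (N n m j : ℕ) (ω : SeqSpace) (A : Set (Fin j → unitInterval))
    (B : Set (Fin (n - m - j + 1) → unitInterval)) : ℝ :=
  (1 / (N : ℝ)) * ∑ i ∈ Finset.range N,
    A.indicator (fun _ => (1 : ℝ)) (block ω (i * n) j) *
      B.indicator (fun _ => (1 : ℝ)) (block ω (i * n + (j + m - 1)) (n - m - j + 1))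

/-- The estimator `max_{1 ≤ j ≤ n-m} ½ ∑_A ∑_B |joint(A, B) - μ_N(A) μ_N(B)|`, with `A`, `B` running
over the dyadic cubes of dimensions `j` and `n - m - j + 1`. When `m ≥ n` there is no admissible
`j`, and the value is `0`. -/
def betaHat (N n ℓ : ℕ) (ω : SeqSpace) (m : ℕ) : ℝ :=
  ⨆ j : Finset.Icc 1 (n - m),
    (1 / 2 : ℝ) * ∑ a : Fin (j : ℕ) → Fin (2 ^ ℓ), ∑ b : Fin (n - m - j + 1) → Fin (2 ^ ℓ),
      |empJoint N n m j ω (dyadicCube j ℓ a) (dyadicCube (n - m - j + 1) ℓ b)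
        - empMeasure N ω (dyadicCube j ℓ a) * empMeasure N ω (dyadicCube (n - m - j + 1) ℓ b)|

/-- The constant `C_{m,ℓ,k} = m 2^{2^{2kℓ+1} + 2^{mℓ+1} + 2}`. -/
def betaConst (m ℓ k : ℕ) : ℝ :=
  (m : ℝ) * 2 ^ (2 ^ (2 * k * ℓ + 1) + 2 ^ (m * ℓ + 1) + 2)

/-- The number of blocks `C_{m,ℓ,n} / (m ε² δ)`, rounded up to an integer. -/
def numBlocks (m ℓ n : ℕ) (ε δ : ℝ) : ℕ :=
  ⌈betaConst m ℓ n / ((m : ℝ) * ε ^ 2 * δ)⌉₊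

/-! ### The test -/

open Classical in
/-- The test at stage `t`: `+1` if the estimate of `β(m)` is at most `γ(m) + ε_t` for all
`m ∈ {1, …, M_t}`, and `-1` otherwise. -/
def betaTest (γ : ℕ → ℝ) (M ℓ n : ℕ → ℕ) (ε δ : ℕ → ℝ) (t : ℕ) (ω : SeqSpace) : ℤ :=
  if ∀ m ∈ Finset.Icc 1 (M t),
      betaHat (numBlocks m (ℓ t) (n t) (ε t) (δ t)) (n t) (ℓ t) ω m ≤ γ m + ε t
  then 1 else -1

/-- The number of observations available at stage `t`: `n_t` times the largest number of blocks
used for some `m ∈ {1, …, M_t}`. -/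
def sampleSize (M ℓ n : ℕ → ℕ) (ε δ : ℕ → ℝ) (t : ℕ) : ℕ :=
  n t * (Finset.Icc 1 (M t)).sup fun m => numBlocks m (ℓ t) (n t) (ε t) (δ t)

end

/-! Fix `m`. For a level `ℓ` and window lengths `j`, `k`, replace the past `X_1, …, X_j` and the
future `X_{j+m}, …, X_{j+m+k-1}` by their dyadic codes, and take half the `ℓ¹` distance between the
joint law of the codes and the product of their laws (`discreteDep`). This quantity never exceeds
`β(m)` (`discreteDep_le_betaCoeff`). It also exhausts `β(m)` from below: for `c < β(m)` some `j`
makes it exceed `c` for all large `ℓ` and `k` (`exists_lt_discreteDep`), because dyadic events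
approximate every event of the product σ-algebra.

The `j`-th term of the estimator is the empirical version with `k = n - m - j + 1`. Events in two
blocks have covariance at most a β-coefficient of the gap between them, so summability gives every
empirical frequency variance at most `(1 + 2 ∑ β) / N` (`integral_sq_empFreq_sub_le`). Chebyshev
over all cells (`measureReal_estDep_sub_ge_le`), the size of the block number and a union bound over
the pairs `(m, j)` give a failure probability of at most a constant times `δ_t`. By Borel–Cantelli
all terms are almost surely eventually within `ε_t` of their targets
(`ae_eventually_abs_estDep_sub_lt`).

Under the null hypothesis every term is then at most `β(m) + ε_t ≤ γ(m) + ε_t`. Otherwise pick `m`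
and `c` with `γ(m) < c < β(m)`: one fixed `j` eventually forces the estimate above `c - ε_t`, hence
above `γ(m) + ε_t`. -/

/-! ### Dyadic digits -/

/-- The index of the dyadic interval of level `ℓ` that contains `x`. -/
noncomputable def dyadicDigit (ℓ : ℕ) (x : unitInterval) : Fin (2 ^ ℓ) :=
  ⟨min ⌊(x : ℝ) * 2 ^ ℓ⌋₊ (2 ^ ℓ - 1), by have := Nat.two_pow_pos ℓ; omega⟩

theorem dyadicDigit_val (ℓ : ℕ) (x : unitInterval) :
    (dyadicDigit ℓ x : ℕ) = min ⌊(x : ℝ) * 2 ^ ℓ⌋₊ (2 ^ ℓ - 1) := rfl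

/-- The truncation in `dyadicDigit` acts only at `x = 1`, the one point with floor `2 ^ ℓ`; this
matches the closed right end of the last cell. -/
theorem mem_dyadicCell_iff {ℓ : ℕ} {i : Fin (2 ^ ℓ)} {x : unitInterval} :
    x ∈ dyadicCell ℓ i ↔ dyadicDigit ℓ x = i := by
  have h2 : (0 : ℝ) < 2 ^ ℓ := by positivity
  have hx0 := x.2.1
  have hx1 := x.2.2
  have hi := i.2
  have hnn : 0 ≤ (x : ℝ) * 2 ^ ℓ := by positivity
  have hle : ⌊(x : ℝ) * 2 ^ ℓ⌋₊ ≤ 2 ^ ℓ := by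
    apply Nat.floor_le_of_le
    push_cast
    nlinarith
  rw [Fin.ext_iff, dyadicDigit_val]
  simp only [dyadicCell, Set.mem_ofPred_eq]
  rw [div_le_iff₀ h2, lt_div_iff₀ h2, ← Nat.le_floor_iff hnn]
  have hlt : (x : ℝ) * 2 ^ ℓ < (i : ℕ) + 1 ↔ ⌊(x : ℝ) * 2 ^ ℓ⌋₊ < (i : ℕ) + 1 := by
    rw [Nat.floor_lt hnn]
    push_cast
    rfl
  rw [hlt]
  have hone : (x : ℝ) = 1 ↔ ⌊(x : ℝ) * 2 ^ ℓ⌋₊ = 2 ^ ℓ := by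
    constructor
    · intro h
      rw [h, one_mul]
      exact_mod_cast Nat.floor_natCast (R := ℝ) (2 ^ ℓ)
    · intro h
      have := Nat.floor_le hnn
      rw [h] at this
      push_cast at this
      nlinarith
  rw [hone]
  omega

theorem abs_sub_dyadicDigit_le (ℓ : ℕ) (x : unitInterval) :
    |(dyadicDigit ℓ x : ℕ) / (2 : ℝ) ^ ℓ - x| ≤ (1 / 2) ^ ℓ := by
  have h2 : (0 : ℝ) < 2 ^ ℓ := by positivity
  obtain ⟨h, h'⟩ := mem_dyadicCell_iff.2 (rfl : dyadicDigit ℓ x = _)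
  have hi : ((dyadicDigit ℓ x : ℕ) : ℝ) + 1 ≤ 2 ^ ℓ := by exact_mod_cast (dyadicDigit ℓ x).2
  rw [one_div, inv_pow, inv_eq_one_div, abs_le]
  rw [add_div] at h'
  rcases h' with h' | ⟨h', h''⟩
  · constructor <;> linarith [one_div_pos.2 h2]
  · have : ((dyadicDigit ℓ x : ℕ) : ℝ) + 1 = 2 ^ ℓ := by exact_mod_cast h'
    have h3 : ((dyadicDigit ℓ x : ℕ) : ℝ) / 2 ^ ℓ + 1 / 2 ^ ℓ = 1 := by
      rw [← add_div, this, div_self h2.ne']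
    constructor <;> linarith [one_div_pos.2 h2]

theorem tendsto_dyadicDigit (x : unitInterval) :
    Tendsto (fun ℓ => (dyadicDigit ℓ x : ℕ) / (2 : ℝ) ^ ℓ) atTop (𝓝 x) := by
  rw [tendsto_iff_dist_tendsto_zero]
  exact squeeze_zero (fun _ => dist_nonneg) (fun ℓ => abs_sub_dyadicDigit_le ℓ x)
    (tendsto_pow_atTop_nhds_zero_of_lt_one (by norm_num) (by norm_num))

/-- Coarsening drops the low-order bits, and this commutes with the truncation. Hence the dyadic
partitions are nested. -/
theorem dyadicDigit_eq_div {ℓ ℓ' : ℕ} (h : ℓ ≤ ℓ') (x : unitInterval) :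
    (dyadicDigit ℓ x : ℕ) = (dyadicDigit ℓ' x : ℕ) / 2 ^ (ℓ' - ℓ) := by
  obtain ⟨d, rfl⟩ := Nat.exists_eq_add_of_le h
  have hd := Nat.two_pow_pos d
  have hl := Nat.two_pow_pos ℓ
  have h1 : ⌊(x : ℝ) * 2 ^ (ℓ + d)⌋₊ / 2 ^ d = ⌊(x : ℝ) * 2 ^ ℓ⌋₊ := by
    rw [← Nat.floor_div_natCast]
    congr 1
    push_cast
    rw [pow_add]
    field_simp
  have h2 : (2 ^ (ℓ + d) - 1) / 2 ^ d = 2 ^ ℓ - 1 := by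
    rw [pow_add]
    apply Nat.div_eq_of_lt_le
    · rw [Nat.sub_mul]
      omega
    · rw [Nat.sub_add_cancel hl]
      have := Nat.mul_pos hl hd
      omega
  rw [dyadicDigit_val, dyadicDigit_val, Nat.add_sub_cancel_left, ← h1, ← h2]
  exact (Monotone.map_min (f := fun a : ℕ => a / 2 ^ d)
    fun a b hab => Nat.div_le_div_right hab).symm

theorem measurable_dyadicDigit (ℓ : ℕ) : Measurable (dyadicDigit ℓ) := by
  refine measurable_to_countable' fun i => ?_
  have : dyadicDigit ℓ ⁻¹' {i} = dyadicCell ℓ i := by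
    ext x
    simp [mem_dyadicCell_iff]
  rw [this]
  have hx : Measurable fun x : unitInterval => (x : ℝ) := measurable_subtype_coe
  exact (measurableSet_le measurable_const hx).inter ((measurableSet_lt hx measurable_const).union
    ((MeasurableSet.const _).inter (measurableSet_eq_fun hx measurable_const)))

/-- The dyadic digits at level `ℓ` of the observations `X_{s+1}, …, X_{s+k}`. -/
noncomputable def dyadicCode (ℓ s k : ℕ) (ω : SeqSpace) : Fin k → Fin (2 ^ ℓ) :=
  fun p => dyadicDigit ℓ (ω (s + p))

theorem block_mem_dyadicCube_iff {ℓ s k : ℕ} {ω : SeqSpace} {a : Fin k → Fin (2 ^ ℓ)} :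
    block ω s k ∈ dyadicCube k ℓ a ↔ dyadicCode ℓ s k ω = a := by
  simp [dyadicCube, block, dyadicCode, mem_dyadicCell_iff, funext_iff]

theorem measurable_coord_coordSigma {S : Set ℕ} {s : ℕ} (hs : s ∈ S) :
    Measurable[coordSigma S] fun ω : SeqSpace => ω s :=
  Measurable.mono (comap_measurable _)
    (le_iSup₂ (f := fun s (_ : s ∈ S) =>
      MeasurableSpace.comap (fun ω : SeqSpace => ω s) inferInstance) s hs) le_rfl

theorem measurable_dyadicCode_coordSigma {S : Set ℕ} {ℓ s k : ℕ} (h : ∀ p < k, s + p ∈ S) :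
    Measurable[coordSigma S] (dyadicCode ℓ s k) :=
  @measurable_pi_iff _ _ _ (coordSigma S) _ _ |>.2 fun p =>
    (measurable_dyadicDigit ℓ).comp (measurable_coord_coordSigma (h p p.2))

theorem measurable_dyadicCode (ℓ s k : ℕ) : Measurable (dyadicCode ℓ s k) :=
  (measurable_dyadicCode_coordSigma (S := Set.univ) fun _ _ => trivial).mono
    (coordSigma_le _) le_rfl

theorem exists_dyadicCode_factor {ℓ ℓ' k k' : ℕ} (hℓ : ℓ ≤ ℓ') (hk : k ≤ k') (s : ℕ) :
    ∃ g : (Fin k' → Fin (2 ^ ℓ')) → Fin k → Fin (2 ^ ℓ),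
      dyadicCode ℓ s k = g ∘ dyadicCode ℓ' s k' := by
  refine ⟨fun c p => ⟨(c (Fin.castLE hk p) : ℕ) / 2 ^ (ℓ' - ℓ), ?_⟩, ?_⟩
  · apply Nat.div_lt_of_lt_mul
    rw [← pow_add, Nat.sub_add_cancel hℓ]
    exact (c _).2
  · ext ω p
    exact dyadicDigit_eq_div hℓ _

theorem coordSigma_mono {S T : Set ℕ} (h : S ⊆ T) : coordSigma S ≤ coordSigma T :=
  biSup_mono fun _ hs => h hs

/-! ### The shift -/

theorem shiftMap_iterate (r : ℕ) (ω : SeqSpace) : shiftMap^[r] ω = fun s => ω (s + r) := by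
  induction r generalizing ω with
  | zero => rfl
  | succ r ih =>
    rw [Function.iterate_succ_apply, ih]
    ext s
    simp [shiftMap, add_assoc]

theorem dyadicCode_shift (ℓ s k r : ℕ) (ω : SeqSpace) :
    dyadicCode ℓ s k (shiftMap^[r] ω) = dyadicCode ℓ (r + s) k ω := by
  ext p
  simp only [dyadicCode, shiftMap_iterate]
  congr 3
  omega

/-! ### The β-dependence coefficient -/

theorem prod_measurableSpace_mono {Ω : Type*} {U V U' V' : MeasurableSpace Ω} (hU : U ≤ U')
    (hV : V ≤ V') : U.prod V ≤ U'.prod V' :=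
  sup_le_sup (MeasurableSpace.comap_mono hU) (MeasurableSpace.comap_mono hV)

section BetaDep

variable {Ω : Type*} {U V : MeasurableSpace Ω} [mΩ : MeasurableSpace Ω] (μ : Measure Ω)

/-- The discrepancy on `W` between the diagonal image of `μ` and the product measure. -/
noncomputable def depGap (W : Set (Ω × Ω)) : ℝ :=
  μ.real {ω | (ω, ω) ∈ W} - (μ.prod μ).real W

/-- Trimming is pushing forward along the identity, so both measures on `U ⊗ V` are restrictions of
measures independent of `U` and `V`. One functional `depGap` then serves all pairs of
sub-σ-algebras. -/
theorem betaDep_eq [IsProbabilityMeasure μ] (hU : U ≤ mΩ) (hV : V ≤ mΩ) :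
    betaDep μ U V hU hV =
      ⨆ W : {W : Set (Ω × Ω) // MeasurableSet[U.prod V] W}, |depGap μ W.1| := by
  refine iSup_congr fun W => ?_
  have hdiag : @Measurable Ω (Ω × Ω) mΩ (U.prod V) fun ω => (ω, ω) :=
    (measurable_id.prodMk measurable_id).mono le_rfl (prod_measurableSpace_mono hU hV)
  have h1 : (@Measure.map Ω (Ω × Ω) mΩ (U.prod V) (fun ω => (ω, ω)) μ W.1) =
      μ {ω | (ω, ω) ∈ W.1} := by
    rw [@Measure.map_apply _ _ mΩ (U.prod V) _ _ hdiag _ W.2]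
    rfl
  have h2 : (@Measure.prod Ω Ω U V (μ.trim hU) (μ.trim hV) W.1) = (μ.prod μ) W.1 := by
    rw [trim_eq_map, trim_eq_map,
      @Measure.map_prod_map Ω Ω Ω mΩ U mΩ Ω V id id μ μ _ _ (measurable_id'' hU)
        (measurable_id'' hV),
      @Measure.map_apply _ _ (mΩ.prod mΩ) (U.prod V) _ _
        (@Measurable.prodMap _ _ _ _ mΩ U mΩ V _ _ (measurable_id'' hU)
        (measurable_id'' hV)) _ W.2]
    rfl
  rw [h1, h2]
  rfl

theorem abs_depGap_le_one [IsProbabilityMeasure μ] (W : Set (Ω × Ω)) : |depGap μ W| ≤ 1 := by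
  rw [depGap, abs_le]
  constructor <;>
  linarith [measureReal_nonneg (μ := μ) (s := {ω | (ω, ω) ∈ W}),
    measureReal_nonneg (μ := μ.prod μ) (s := W),
    measureReal_le_one (μ := μ) (s := {ω | (ω, ω) ∈ W}),
    measureReal_le_one (μ := μ.prod μ) (s := W)]

theorem abs_depGap_le_betaDep [IsProbabilityMeasure μ] (hU : U ≤ mΩ)
    (hV : V ≤ mΩ) {W : Set (Ω × Ω)} (hW : MeasurableSet[U.prod V] W) :
    |depGap μ W| ≤ betaDep μ U V hU hV := by
  rw [betaDep_eq]
  exact le_ciSup (f := fun W : {W : Set (Ω × Ω) // MeasurableSet[U.prod V] W} => |depGap μ W.1|)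
    ⟨1, by rintro _ ⟨W, rfl⟩; exact abs_depGap_le_one μ _⟩ ⟨W, hW⟩

theorem exists_lt_abs_depGap [IsProbabilityMeasure μ] (hU : U ≤ mΩ)
    (hV : V ≤ mΩ) {c : ℝ} (hc : c < betaDep μ U V hU hV) :
    ∃ W, MeasurableSet[U.prod V] W ∧ c < |depGap μ W| := by
  rw [betaDep_eq] at hc
  have : Nonempty {W : Set (Ω × Ω) // MeasurableSet[U.prod V] W} :=
    ⟨∅, @MeasurableSet.empty _ (U.prod V)⟩
  obtain ⟨W, hW⟩ := exists_lt_of_lt_ciSup hc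
  exact ⟨W, W.2, hW⟩

theorem betaDep_le_one [IsProbabilityMeasure μ] (hU : U ≤ mΩ)
    (hV : V ≤ mΩ) : betaDep μ U V hU hV ≤ 1 := by
  rw [betaDep_eq]
  have : Nonempty {W : Set (Ω × Ω) // MeasurableSet[U.prod V] W} :=
    ⟨∅, @MeasurableSet.empty _ (U.prod V)⟩
  exact ciSup_le fun W => abs_depGap_le_one μ _

theorem betaDep_nonneg (hU : U ≤ mΩ)
    (hV : V ≤ mΩ) : 0 ≤ betaDep μ U V hU hV :=
  Real.iSup_nonneg fun _ => abs_nonneg _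

theorem abs_cov_le_betaDep [IsProbabilityMeasure μ] (hU : U ≤ mΩ)
    (hV : V ≤ mΩ) {A B : Set Ω} (hA : MeasurableSet[U] A) (hB : MeasurableSet[V] B) :
    |μ.real (A ∩ B) - μ.real A * μ.real B| ≤ betaDep μ U V hU hV := by
  have h := abs_depGap_le_betaDep μ hU hV (W := A ×ˢ B)
    (@MeasurableSet.prod _ _ U V _ _ hA hB)
  rw [depGap, measureReal_prod_prod] at h
  exact h

end BetaDep

theorem bddAbove_betaDep (μ : Measure SeqSpace) [IsProbabilityMeasure μ] (m : ℕ) :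
    BddAbove (Set.range fun j : ℕ+ =>
      betaDep μ (coordSigma {s | s + 1 ≤ (j : ℕ)}) (coordSigma {s | (j : ℕ) + m ≤ s + 1})
        (coordSigma_le _) (coordSigma_le _)) :=
  ⟨1, by rintro _ ⟨j, rfl⟩; exact betaDep_le_one μ _ _⟩

theorem betaDep_le_betaCoeff (μ : Measure SeqSpace) [IsProbabilityMeasure μ] (m : ℕ) {j : ℕ}
    (hj : 1 ≤ j) :
    betaDep μ (coordSigma {s | s + 1 ≤ j}) (coordSigma {s | j + m ≤ s + 1})
      (coordSigma_le _) (coordSigma_le _) ≤ betaCoeff μ m :=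
  le_ciSup (bddAbove_betaDep μ m) (⟨j, hj⟩ : ℕ+)

theorem betaCoeff_nonneg (μ : Measure SeqSpace) (m : ℕ) : 0 ≤ betaCoeff μ m :=
  Real.iSup_nonneg fun _ => betaDep_nonneg μ _ _

theorem abs_cov_le_betaCoeff (μ : Measure SeqSpace) [IsProbabilityMeasure μ] {m j : ℕ}
    (hj : 1 ≤ j) {A B : Set SeqSpace} (hA : MeasurableSet[coordSigma {s | s + 1 ≤ j}] A)
    (hB : MeasurableSet[coordSigma {s | j + m ≤ s + 1}] B) :
    |μ.real (A ∩ B) - μ.real A * μ.real B| ≤ betaCoeff μ m :=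
  (abs_cov_le_betaDep μ (coordSigma_le _) (coordSigma_le _) hA hB).trans
    (betaDep_le_betaCoeff μ m hj)

/-! ### Discretised dependence -/

section Discrete

variable {Ω : Type*} {U V : MeasurableSpace Ω} [mΩ : MeasurableSpace Ω] (μ : Measure Ω)
  {α β : Type*} [MeasurableSpace α] [MeasurableSpace β]
  [MeasurableSingletonClass α] [MeasurableSingletonClass β]

theorem depGap_preimage [IsProbabilityMeasure μ] {X : Ω → α} {Y : Ω → β} (hX : Measurable X)
    (hY : Measurable Y) (T : Finset (α × β)) :
    depGap μ {w | (X w.1, Y w.2) ∈ T} = ∑ c ∈ T, (μ.real {ω | X ω = c.1 ∧ Y ω = c.2} -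
      μ.real {ω | X ω = c.1} * μ.real {ω | Y ω = c.2}) := by
  have hXa (a : α) : MeasurableSet {ω | X ω = a} := hX (measurableSet_singleton a)
  have hYb (b : β) : MeasurableSet {ω | Y ω = b} := hY (measurableSet_singleton b)
  have h1 : {ω | (ω, ω) ∈ {w : Ω × Ω | (X w.1, Y w.2) ∈ T}} =
      ⋃ c ∈ T, {ω | X ω = c.1 ∧ Y ω = c.2} := by
    ext ω
    simp [and_comm]
  have h2 : {w : Ω × Ω | (X w.1, Y w.2) ∈ T} =
      ⋃ c ∈ T, {ω | X ω = c.1} ×ˢ {ω | Y ω = c.2} := by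
    ext ω
    simp [and_comm]
  rw [depGap, h1, h2, measureReal_biUnion_finset, measureReal_biUnion_finset,
    ← Finset.sum_sub_distrib]
  · exact Finset.sum_congr rfl fun c _ => by rw [measureReal_prod_prod]
  · intro c _ d _ hcd
    refine Set.disjoint_left.2 fun w hw hw' => hcd ?_
    exact Prod.ext (hw.1.symm.trans hw'.1) (hw.2.symm.trans hw'.2)
  · exact fun c _ => (hXa _).prod (hYb _)
  · intro c _ d _ hcd
    refine Set.disjoint_left.2 fun w hw hw' => hcd ?_
    exact Prod.ext (hw.1.symm.trans hw'.1) (hw.2.symm.trans hw'.2)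
  · exact fun c _ => (hXa _).inter (hYb _)

variable [Fintype α] [Fintype β]

/-- Half the `ℓ¹` distance between the joint law of two finitely valued random variables and the
product of their laws. -/
noncomputable def discreteDep (X : Ω → α) (Y : Ω → β) : ℝ :=
  (1 / 2 : ℝ) * ∑ a, ∑ b, |μ.real {ω | X ω = a ∧ Y ω = b} -
    μ.real {ω | X ω = a} * μ.real {ω | Y ω = b}|

theorem sum_discrepancy_eq_zero [IsProbabilityMeasure μ] {X : Ω → α} {Y : Ω → β}
    (hX : Measurable X) (hY : Measurable Y) :
    ∑ c : α × β, (μ.real {ω | X ω = c.1 ∧ Y ω = c.2} -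
      μ.real {ω | X ω = c.1} * μ.real {ω | Y ω = c.2}) = 0 := by
  rw [← depGap_preimage μ hX hY]
  simp [depGap]

/-- The sums over `T` and over its complement are opposite, so they have the same absolute value. -/
theorem two_mul_abs_sum_le_of_sum_eq_zero {ι : Type*} [Fintype ι] [DecidableEq ι] {d : ι → ℝ}
    (h : ∑ i, d i = 0) (T : Finset ι) :
    2 * |∑ i ∈ T, d i| ≤ ∑ i, |d i| := by
  have h1 : ∑ i ∈ T, d i = -∑ i ∈ Tᶜ, d i := by linarith [Finset.sum_add_sum_compl T d]
  have h2 := Finset.sum_add_sum_compl T fun i => |d i|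
  have h3 := Finset.abs_sum_le_sum_abs d T
  have h4 := Finset.abs_sum_le_sum_abs d Tᶜ
  have h5 : |∑ i ∈ T, d i| = |∑ i ∈ Tᶜ, d i| := by rw [h1, abs_neg]
  linarith

theorem abs_depGap_preimage_le [IsProbabilityMeasure μ] {X : Ω → α} {Y : Ω → β}
    (hX : Measurable X) (hY : Measurable Y) (T : Set (α × β)) :
    |depGap μ {w | (X w.1, Y w.2) ∈ T}| ≤ discreteDep μ X Y := by
  classical
  have h := two_mul_abs_sum_le_of_sum_eq_zero (sum_discrepancy_eq_zero μ hX hY) T.toFinset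
  have h' := depGap_preimage μ hX hY T.toFinset
  simp only [Set.mem_toFinset] at h'
  rw [← h', Fintype.sum_prod_type] at h
  rw [discreteDep]
  linarith

/-- The witness collects the cells of nonnegative discrepancy: as the discrepancies sum to zero,
their positive part is half the `ℓ¹` norm. -/
theorem exists_discreteDep_eq [IsProbabilityMeasure μ] {X : Ω → α} {Y : Ω → β}
    (hX : Measurable X) (hY : Measurable Y) :
    ∃ T : Finset (α × β), discreteDep μ X Y = depGap μ {w | (X w.1, Y w.2) ∈ T} := by
  classical
  set d : α × β → ℝ := fun c => μ.real {ω | X ω = c.1 ∧ Y ω = c.2} -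
      μ.real {ω | X ω = c.1} * μ.real {ω | Y ω = c.2} with hd
  have h0 : ∑ c, d c = 0 := sum_discrepancy_eq_zero μ hX hY
  refine ⟨Finset.univ.filter fun c => 0 ≤ d c, ?_⟩
  rw [depGap_preimage μ hX hY, Finset.sum_filter]
  have h1 : ∑ c, |d c| = ∑ c, (2 * (if 0 ≤ d c then d c else 0) - d c) := by
    refine Finset.sum_congr rfl fun c _ => ?_
    split_ifs with hc
    · rw [abs_of_nonneg hc]; ring
    · rw [abs_of_neg (not_le.1 hc)]; ring
  rw [Finset.sum_sub_distrib, h0, ← Finset.mul_sum, Fintype.sum_prod_type] at h1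
  rw [discreteDep]
  linarith

theorem discreteDep_le_betaDep [IsProbabilityMeasure μ] (hU : U ≤ mΩ)
    (hV : V ≤ mΩ) {X : Ω → α} {Y : Ω → β}
    (hX : Measurable[U] X) (hY : Measurable[V] Y) :
    discreteDep μ X Y ≤ betaDep μ U V hU hV := by
  obtain ⟨T, hT⟩ := exists_discreteDep_eq μ (hX.mono hU le_rfl) (hY.mono hV le_rfl)
  rw [hT]
  refine (le_abs_self _).trans (abs_depGap_le_betaDep μ hU hV ?_)
  have h1 : @Measurable _ _ (U.prod V) _ (fun w : Ω × Ω => (X w.1, Y w.2)) :=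
    @Measurable.prodMk _ (U.prod V) _ _ _ _ _ _ (hX.comp (@measurable_fst _ _ U V))
      (hY.comp (@measurable_snd _ _ U V))
  exact h1 T.measurableSet

end Discrete

/-! ### Empirical frequencies of stationary sequences -/

theorem measurable_shiftMap_iterate_coordSigma (r k : ℕ) :
    @Measurable _ _ (coordSigma {s | r ≤ s ∧ s < r + k}) (coordSigma {s | s < k})
      (shiftMap^[r]) := by
  rw [measurable_iff_comap_le, coordSigma, MeasurableSpace.comap_iSup]
  refine iSup_le fun s => ?_
  rw [MeasurableSpace.comap_iSup]
  refine iSup_le fun hs => ?_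
  rw [MeasurableSpace.comap_comp, ← measurable_iff_comap_le]
  have h : (fun ω : SeqSpace => ω s) ∘ shiftMap^[r] = fun ω => ω (s + r) := by
    ext ω
    simp [shiftMap_iterate]
  rw [h]
  have hs' : s < k := hs
  exact measurable_coord_coordSigma ⟨by omega, by omega⟩

/-- The relative frequency of the event `E` among the first `N` blocks of length `k`. -/
noncomputable def empFreq (N k : ℕ) (E : Set SeqSpace) (ω : SeqSpace) : ℝ :=
  (1 / (N : ℝ)) * ∑ i ∈ Finset.range N, E.indicator (fun _ => (1 : ℝ)) (shiftMap^[i * k] ω)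

theorem empFreq_nonneg (N k : ℕ) (E : Set SeqSpace) (ω : SeqSpace) : 0 ≤ empFreq N k E ω :=
  mul_nonneg (by positivity)
    (Finset.sum_nonneg fun _ _ => Set.indicator_nonneg (fun _ _ => zero_le_one) _)

theorem empFreq_le_one (N k : ℕ) (E : Set SeqSpace) (ω : SeqSpace) : empFreq N k E ω ≤ 1 := by
  have h : ∑ i ∈ Finset.range N, E.indicator (fun _ => (1 : ℝ)) (shiftMap^[i * k] ω) ≤ N := by
    calc _ ≤ ∑ i ∈ Finset.range N, (1 : ℝ) :=
          Finset.sum_le_sum fun _ _ => Set.indicator_le_self' (fun _ _ => zero_le_one) _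
      _ = N := by simp
  rw [empFreq, one_div, inv_mul_eq_div]
  exact div_le_one_of_le₀ h (by positivity)

theorem measurable_empFreq {S : Set ℕ} {N k : ℕ} {E : Set SeqSpace}
    (hE : MeasurableSet[coordSigma {s | s < k}] E) (hS : ∀ s < N * k, s ∈ S) :
    Measurable[coordSigma S] (empFreq N k E) := by
  refine Measurable.const_mul (@Finset.measurable_sum _ _ _ _ _ _ (coordSigma S) _ _ fun i hi => ?_) _
  refine (@measurable_const _ _ _ (coordSigma {s | s < k}) (1 : ℝ)).indicator hE |>.comp ?_
  refine (measurable_shiftMap_iterate_coordSigma (i * k) k).mono (coordSigma_mono ?_) le_rfl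
  rintro s ⟨-, hs⟩
  apply hS
  have := Finset.mem_range.1 hi
  calc s < i * k + k := hs
    _ = (i + 1) * k := by ring
    _ ≤ N * k := Nat.mul_le_mul_right _ this

/-! ### Variance of block frequencies under summable β-mixing -/

section Variance

variable {μ : Measure SeqSpace}

theorem measureReal_preimage_shift (hst : MeasurePreserving shiftMap μ μ) (r : ℕ)
    {E : Set SeqSpace} (hE : MeasurableSet E) : μ.real (shiftMap^[r] ⁻¹' E) = μ.real E := by
  rw [measureReal_def, (hst.iterate r).measure_preimage hE.nullMeasurableSet, measureReal_def]

theorem sum_range_betaCoeff_le (hsum : Summable fun i : ℕ => betaCoeff μ (i + 1)) {k : ℕ}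
    (hk : 1 ≤ k) (N : ℕ) :
    ∑ d ∈ Finset.range N, betaCoeff μ (d * k + 1) ≤ ∑' i, betaCoeff μ (i + 1) := by
  have hinj : Set.InjOn (fun d => d * k) (Finset.range N) :=
    fun a _ b _ h => Nat.eq_of_mul_eq_mul_right hk h
  rw [← Finset.sum_image (f := fun i => betaCoeff μ (i + 1)) hinj]
  exact hsum.sum_le_tsum _ fun _ _ => betaCoeff_nonneg μ _

variable [IsProbabilityMeasure μ]

/-- Block `i` ends at time `(i + 1) * k` and block `i + d + 1` begins `d * k + 1` later. -/
theorem abs_cov_shift_le (hst : MeasurePreserving shiftMap μ μ) {k : ℕ} (hk : 1 ≤ k)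
    {E : Set SeqSpace} (hE : MeasurableSet[coordSigma {s | s < k}] E) (i d : ℕ) :
    |μ.real (shiftMap^[i * k] ⁻¹' E ∩ shiftMap^[(i + d + 1) * k] ⁻¹' E) - μ.real E ^ 2| ≤
      betaCoeff μ (d * k + 1) := by
  have hE' : MeasurableSet E := coordSigma_le _ _ hE
  have h := abs_cov_le_betaCoeff μ (m := d * k + 1) (j := (i + 1) * k) (by nlinarith)
    (A := shiftMap^[i * k] ⁻¹' E) (B := shiftMap^[(i + d + 1) * k] ⁻¹' E) ?_ ?_
  · rwa [measureReal_preimage_shift hst _ hE', measureReal_preimage_shift hst _ hE', ← sq] at h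
  · refine coordSigma_mono ?_ _ (measurable_shiftMap_iterate_coordSigma _ k hE)
    rintro s ⟨-, hs⟩
    have : i * k + k = (i + 1) * k := by ring
    simp only [Set.mem_ofPred_eq]
    omega
  · refine coordSigma_mono ?_ _ (measurable_shiftMap_iterate_coordSigma _ k hE)
    rintro s ⟨hs, -⟩
    have : (i + d + 1) * k = (i + 1) * k + d * k := by ring
    simp only [Set.mem_ofPred_eq]
    omega

/-- Going from `N` to `N + 1` adds a row and a column, each at most `S`, and one diagonal term, at
most `1`. -/
theorem sum_sum_le_of_symm {c : ℕ → ℕ → ℝ} {b : ℕ → ℝ} {S : ℝ} (hsymm : ∀ i j, c i j = c j i)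
    (hdiag : ∀ i, c i i ≤ 1) (hoff : ∀ i d, c i (i + d + 1) ≤ b d)
    (hb : ∀ N, ∑ d ∈ Finset.range N, b d ≤ S) (N : ℕ) :
    ∑ i ∈ Finset.range N, ∑ j ∈ Finset.range N, c i j ≤ N * (1 + 2 * S) := by
  induction N with
  | zero => simp
  | succ N ih =>
    have h1 : ∑ i ∈ Finset.range N, c i N ≤ S := by
      refine le_trans ?_ (hb N)
      rw [← Finset.sum_range_reflect b N]
      refine Finset.sum_le_sum fun i hi => ?_
      have hi := Finset.mem_range.1 hi
      have h := hoff i (N - 1 - i)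
      rwa [show i + (N - 1 - i) + 1 = N by omega] at h
    have h2 : ∑ j ∈ Finset.range N, c N j = ∑ i ∈ Finset.range N, c i N :=
      Finset.sum_congr rfl fun j _ => hsymm _ _
    simp only [Finset.sum_range_succ, Finset.sum_add_distrib]
    push_cast
    linarith [hdiag N]

theorem integral_sq_empFreq_sub_le (hst : MeasurePreserving shiftMap μ μ)
    (hsum : Summable fun i : ℕ => betaCoeff μ (i + 1)) {k : ℕ} (hk : 1 ≤ k)
    {E : Set SeqSpace} (hE : MeasurableSet[coordSigma {s | s < k}] E) {N : ℕ} (hN : 0 < N) :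
    ∫ ω, (empFreq N k E ω - μ.real E) ^ 2 ∂μ ≤ (1 + 2 * ∑' i, betaCoeff μ (i + 1)) / N := by
  have hE' : MeasurableSet E := coordSigma_le _ _ hE
  set F : ℕ → Set SeqSpace := fun i => shiftMap^[i * k] ⁻¹' E with hF
  have hFm (i : ℕ) : MeasurableSet (F i) := (hst.iterate (i * k)).measurable hE'
  have hFμ (i : ℕ) : μ.real (F i) = μ.real E := measureReal_preimage_shift hst _ hE'
  set f : ℕ → SeqSpace → ℝ := fun i => (F i).indicator fun _ => 1 with hf
  have hfi (i : ℕ) : Integrable (f i) μ := (integrable_const 1).indicator (hFm i)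
  have hff (i j : ℕ) : (fun ω => f i ω * f j ω) = (F i ∩ F j).indicator fun _ => 1 := by
    ext ω
    rw [hf, ← Set.inter_indicator_mul]
    simp
  have hffi (i j : ℕ) : Integrable (fun ω => f i ω * f j ω) μ := by
    rw [hff]
    exact (integrable_const 1).indicator ((hFm i).inter (hFm j))
  have hNR : (0 : ℝ) < N := by exact_mod_cast hN
  set p := μ.real E with hp
  have hexp (ω : SeqSpace) : (empFreq N k E ω - p) ^ 2 = (1 / (N : ℝ) ^ 2) *
      ∑ i ∈ Finset.range N, ∑ j ∈ Finset.range N, (f i ω - p) * (f j ω - p) := by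
    have : empFreq N k E ω - p = (1 / (N : ℝ)) * ∑ i ∈ Finset.range N, (f i ω - p) := by
      rw [Finset.sum_sub_distrib, mul_sub]
      simp only [Finset.sum_const, Finset.card_range, nsmul_eq_mul]
      rw [one_div, inv_mul_cancel_left₀ hNR.ne', empFreq, one_div]
      rfl
    rw [this, mul_pow, sq (∑ i ∈ _, _), Finset.sum_mul_sum]
    simp
  have hprod (i j : ℕ) : ∫ ω, (f i ω - p) * (f j ω - p) ∂μ = μ.real (F i ∩ F j) - p ^ 2 := by
    have h1 : (fun ω => (f i ω - p) * (f j ω - p)) =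
        fun ω => f i ω * f j ω - p * f j ω - p * f i ω + p ^ 2 := by ext; ring
    have h2 (i : ℕ) : ∫ ω, f i ω ∂μ = p := by
      rw [hf, integral_indicator_const _ (hFm i), hFμ]
      simp
    rw [h1, integral_add (f := fun ω => f i ω * f j ω - p * f j ω - p * f i ω)
      (((hffi i j).sub ((hfi j).const_mul p)).sub ((hfi i).const_mul p)) (integrable_const _),
      integral_sub (f := fun ω => f i ω * f j ω - p * f j ω)
      ((hffi i j).sub ((hfi j).const_mul p)) ((hfi i).const_mul p), integral_sub (hffi i j) ((hfi j).const_mul p), integral_const_mul,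
      integral_const_mul, h2, h2, hff, integral_indicator_const _ ((hFm i).inter (hFm j))]
    simp
    ring
  have hpi (i j : ℕ) : Integrable (fun ω => (f i ω - p) * (f j ω - p)) μ := by
    have h1 : (fun ω => (f i ω - p) * (f j ω - p)) =
        fun ω => f i ω * f j ω - p * f j ω - p * f i ω + p ^ 2 := by ext; ring
    rw [h1]
    exact (((hffi i j).sub ((hfi j).const_mul p)).sub ((hfi i).const_mul p)).add
      (integrable_const _)
  simp_rw [hexp]
  rw [integral_const_mul, integral_finsetSum _ fun i _ => integrable_finsetSum _ fun j _ => hpi i j]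
  simp_rw [integral_finsetSum _ fun j _ => hpi _ j, hprod]
  have hle := sum_sum_le_of_symm (c := fun i j => μ.real (F i ∩ F j) - p ^ 2)
    (fun i j => by rw [Set.inter_comm])
    (fun i => by
      have := measureReal_le_one (μ := μ) (s := F i ∩ F i)
      have := sq_nonneg p
      linarith)
    (fun i d => (le_abs_self _).trans (abs_cov_shift_le hst hk hE i d))
    (sum_range_betaCoeff_le hsum hk) N
  calc _ ≤ 1 / (N : ℝ) ^ 2 * (N * (1 + 2 * ∑' i, betaCoeff μ (i + 1))) := by gcongr
    _ = _ := by field_simp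

end Variance

/-- A Chebyshev inequality for the sum of a finite family with bounded second moments. -/
theorem measureReal_le_sum_le {Ω ι : Type*} [MeasurableSpace Ω] {μ : Measure Ω} [Fintype ι]
    {g : ι → Ω → ℝ} (hg : ∀ i, Integrable (fun ω => g i ω ^ 2) μ) {v c : ℝ} (hc : 0 < c)
    (hv : ∀ i, ∫ ω, g i ω ^ 2 ∂μ ≤ v) [IsFiniteMeasure μ] :
    μ.real {ω | c ≤ ∑ i, g i ω} ≤ (Fintype.card ι : ℝ) ^ 2 * v / c ^ 2 := by
  have hint : Integrable (fun ω => (Fintype.card ι : ℝ) * ∑ i, g i ω ^ 2) μ :=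
    (integrable_finsetSum _ fun i _ => hg i).const_mul _
  have h := mul_meas_ge_le_integral_of_nonneg (ae_of_all μ fun ω => by positivity) hint (c ^ 2)
  rw [le_div_iff₀ (by positivity), mul_comm]
  have hsub : {ω | c ≤ ∑ i, g i ω} ⊆ {ω | c ^ 2 ≤ (Fintype.card ι : ℝ) * ∑ i, g i ω ^ 2} := by
    intro ω hω
    have hω' : c ≤ ∑ i, g i ω := hω
    -- Cauchy–Schwarz, so that Markov's inequality applies to a sum of squares.
    exact (pow_le_pow_left₀ hc.le hω' 2).trans sq_sum_le_card_mul_sum_sq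
  calc _ ≤ c ^ 2 * μ.real {ω | c ^ 2 ≤ (Fintype.card ι : ℝ) * ∑ i, g i ω ^ 2} := by
        gcongr
        finiteness
    _ ≤ _ := h
    _ ≤ (Fintype.card ι : ℝ) * ∑ i : ι, v := by
        rw [integral_const_mul, integral_finsetSum _ fun i _ => hg i]
        gcongr with i
        exact hv i
    _ = _ := by simp; ring

/-! ### The estimator -/

/-- The `j`-th term in the maximum defining `betaHat`. -/
noncomputable def estDep (N n ℓ m j : ℕ) (ω : SeqSpace) : ℝ :=
  (1 / 2 : ℝ) * ∑ a : Fin j → Fin (2 ^ ℓ), ∑ b : Fin (n - m - j + 1) → Fin (2 ^ ℓ),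
    |empJoint N n m j ω (dyadicCube j ℓ a) (dyadicCube (n - m - j + 1) ℓ b)
      - empMeasure N ω (dyadicCube j ℓ a) * empMeasure N ω (dyadicCube (n - m - j + 1) ℓ b)|

theorem empMeasure_dyadicCube (N k ℓ : ℕ) (ω : SeqSpace) (a : Fin k → Fin (2 ^ ℓ)) :
    empMeasure N ω (dyadicCube k ℓ a) = empFreq N k {ω | dyadicCode ℓ 0 k ω = a} ω := by
  rw [empMeasure, empFreq]
  congr 1
  refine Finset.sum_congr rfl fun i _ => ?_
  classical
  simp [Set.indicator_apply, block_mem_dyadicCube_iff, dyadicCode_shift]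

theorem empJoint_dyadicCube (N n m j ℓ : ℕ) (ω : SeqSpace) (a : Fin j → Fin (2 ^ ℓ))
    (b : Fin (n - m - j + 1) → Fin (2 ^ ℓ)) :
    empJoint N n m j ω (dyadicCube j ℓ a) (dyadicCube (n - m - j + 1) ℓ b) =
      empFreq N n {ω | dyadicCode ℓ 0 j ω = a ∧ dyadicCode ℓ (j + m - 1) (n - m - j + 1) ω = b}
        ω := by
  rw [empJoint, empFreq]
  congr 1
  refine Finset.sum_congr rfl fun i _ => ?_
  classical
  simp only [Set.indicator_apply, block_mem_dyadicCube_iff, dyadicCode_shift, Set.mem_ofPred_eq,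
    add_zero, ← ite_and, mul_ite, mul_one, mul_zero]
  split_ifs <;> tauto

theorem estDep_eq (N n ℓ m j : ℕ) (ω : SeqSpace) :
    estDep N n ℓ m j ω = (1 / 2 : ℝ) * ∑ a : Fin j → Fin (2 ^ ℓ),
      ∑ b : Fin (n - m - j + 1) → Fin (2 ^ ℓ),
      |empFreq N n {ω | dyadicCode ℓ 0 j ω = a ∧ dyadicCode ℓ (j + m - 1) (n - m - j + 1) ω = b} ω
        - empFreq N j {ω | dyadicCode ℓ 0 j ω = a} ω *
          empFreq N (n - m - j + 1) {ω | dyadicCode ℓ 0 (n - m - j + 1) ω = b} ω| := by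
  simp only [estDep, empMeasure_dyadicCube, empJoint_dyadicCube]

theorem measurableSet_dyadicCode_eq (ℓ k : ℕ) (a : Fin k → Fin (2 ^ ℓ)) :
    MeasurableSet[coordSigma {s | s < k}] {ω | dyadicCode ℓ 0 k ω = a} :=
  measurable_dyadicCode_coordSigma (S := {s | s < k}) (fun p hp => by simpa using hp)
    (measurableSet_singleton a)

theorem measurableSet_dyadicCode_pair_eq {n m j : ℕ} (hm : 1 ≤ m) (hj : 1 ≤ j) (hjn : j + m ≤ n)
    (ℓ : ℕ) (a : Fin j → Fin (2 ^ ℓ)) (b : Fin (n - m - j + 1) → Fin (2 ^ ℓ)) :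
    MeasurableSet[coordSigma {s | s < n}]
      {ω | dyadicCode ℓ 0 j ω = a ∧ dyadicCode ℓ (j + m - 1) (n - m - j + 1) ω = b} :=
  (@MeasurableSet.inter _ (coordSigma {s | s < n}) _ _
    (measurable_dyadicCode_coordSigma (S := {s | s < n})
      (fun p hp => by simp only [Set.mem_ofPred_eq]; omega) (measurableSet_singleton a))
    (measurable_dyadicCode_coordSigma (S := {s | s < n})
      (fun p hp => by simp only [Set.mem_ofPred_eq]; omega) (measurableSet_singleton b)))

theorem measurable_estDep {S : Set ℕ} {N n m j : ℕ} (hm : 1 ≤ m) (hj : 1 ≤ j) (hjn : j + m ≤ n)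
    (hS : ∀ s < N * n, s ∈ S) (ℓ : ℕ) : Measurable[coordSigma S] (estDep N n ℓ m j) := by
  have h : estDep N n ℓ m j = _ := funext (estDep_eq N n ℓ m j)
  rw [h]
  have hS' (k : ℕ) (hk : k ≤ n) : ∀ s < N * k, s ∈ S :=
    fun s hs => hS s (hs.trans_le (Nat.mul_le_mul_left _ hk))
  refine Measurable.const_mul (@Finset.measurable_sum _ _ _ _ _ _ (coordSigma S) _ _ fun a _ =>
    @Finset.measurable_sum _ _ _ _ _ _ (coordSigma S) _ _ fun b _ => ?_) _
  exact measurable_abs.comp <|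
    (measurable_empFreq (measurableSet_dyadicCode_pair_eq hm hj hjn ℓ a b) hS).sub <|
    (measurable_empFreq (measurableSet_dyadicCode_eq ℓ j a) (hS' j (by omega))).mul <|
    measurable_empFreq (measurableSet_dyadicCode_eq ℓ _ b) (hS' _ (by omega))

/-- Telescoping `p q - p' q' = (p - p') q + p' (q - q')`; only the factors `q` and `p'` need to lie
in `[0,1]`. -/
theorem abs_abs_sub_abs_sub_mul_le {J J' p p' q q' : ℝ} (hp0 : 0 ≤ p') (hp1 : p' ≤ 1)
    (hq0 : 0 ≤ q) (hq1 : q ≤ 1) :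
    |(|J - p * q| - |J' - p' * q'|)| ≤ |J - J'| + |p - p'| + |q - q'| := by
  have h1 : |(p - p') * q| ≤ |p - p'| := by
    rw [abs_mul, abs_of_nonneg hq0]
    exact mul_le_of_le_one_right (abs_nonneg _) hq1
  have h2 : |p' * (q - q')| ≤ |q - q'| := by
    rw [abs_mul, abs_of_nonneg hp0]
    exact mul_le_of_le_one_left (abs_nonneg _) hp1
  calc _ ≤ |(J - p * q) - (J' - p' * q')| := abs_abs_sub_abs_le_abs_sub _ _
    _ = |(J - J') + -((p - p') * q) + -(p' * (q - q'))| := by ring_nf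
    _ ≤ |J - J'| + |-((p - p') * q)| + |-(p' * (q - q'))| := abs_add_three _ _ _
    _ ≤ _ := by rw [abs_neg, abs_neg]; gcongr

/-! ### Concentration of one term of the estimator -/

section Concentration

variable {μ : Measure SeqSpace} [IsProbabilityMeasure μ]

theorem integrable_sq_empFreq_sub {N k : ℕ} {E : Set SeqSpace}
    (hE : MeasurableSet[coordSigma {s | s < k}] E) :
    Integrable (fun ω => (empFreq N k E ω - μ.real E) ^ 2) μ := by
  have hm : Measurable (empFreq N k E) :=
    (measurable_empFreq (S := Set.univ) hE fun _ _ => trivial).mono (coordSigma_le _) le_rfl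
  refine Integrable.of_bound ((hm.sub_const _).pow_const 2).aestronglyMeasurable 1
    (ae_of_all _ fun ω => ?_)
  rw [Real.norm_eq_abs, abs_pow, sq_abs]
  have h0 := empFreq_nonneg N k E ω
  have h1 := empFreq_le_one N k E ω
  have h2 := measureReal_nonneg (μ := μ) (s := E)
  have h3 := measureReal_le_one (μ := μ) (s := E)
  rw [sq_le_one_iff_abs_le_one, abs_le]
  constructor <;> linarith

/-- Twice the error is at most the sum of the errors of three frequencies (joint, past, future) over
all pairs of cells, to which the Chebyshev bound for sums applies. The `9` is the square of this
three, and `2 * ε` absorbs the factor `1 / 2`. -/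
theorem measureReal_estDep_sub_ge_le (hst : MeasurePreserving shiftMap μ μ)
    (hsum : Summable fun i : ℕ => betaCoeff μ (i + 1)) {N n m j : ℕ} (hm : 1 ≤ m) (hj : 1 ≤ j)
    (hjn : j + m ≤ n) (hN : 0 < N) (ℓ : ℕ) {ε : ℝ} (hε : 0 < ε) :
    μ.real {ω | ε ≤ |estDep N n ℓ m j ω -
      discreteDep μ (dyadicCode ℓ 0 j) (dyadicCode ℓ (j + m - 1) (n - m - j + 1))|} ≤
      (2 ^ (n * ℓ)) ^ 2 * (9 * ((1 + 2 * ∑' i, betaCoeff μ (i + 1)) / N)) / (2 * ε) ^ 2 := by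
  set k := n - m - j + 1 with hk
  set V := (1 + 2 * ∑' i, betaCoeff μ (i + 1)) / N with hV
  set A : (Fin j → Fin (2 ^ ℓ)) → Set SeqSpace := fun a => {ω | dyadicCode ℓ 0 j ω = a} with hA
  set B : (Fin k → Fin (2 ^ ℓ)) → Set SeqSpace := fun b => {ω | dyadicCode ℓ 0 k ω = b} with hB
  set C : (Fin j → Fin (2 ^ ℓ)) → (Fin k → Fin (2 ^ ℓ)) → Set SeqSpace :=
    fun a b => {ω | dyadicCode ℓ 0 j ω = a ∧ dyadicCode ℓ (j + m - 1) k ω = b} with hC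
  have hAm a := measurableSet_dyadicCode_eq ℓ j a
  have hBm b := measurableSet_dyadicCode_eq ℓ k b
  have hCm a b := measurableSet_dyadicCode_pair_eq hm hj hjn ℓ a b
  -- The future marginal is estimated from blocks starting at time `1`; stationarity identifies
  -- their law with that of the future window.
  have hB' (b) : μ.real {ω | dyadicCode ℓ (j + m - 1) k ω = b} = μ.real (B b) := by
    rw [← measureReal_preimage_shift hst (j + m - 1) (coordSigma_le _ _ (hBm b))]
    congr 1
    ext ω
    simp [dyadicCode_shift]
  let x : ((Fin j → Fin (2 ^ ℓ)) × (Fin k → Fin (2 ^ ℓ))) → SeqSpace → ℝ :=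
    fun c ω => empFreq N n (C c.1 c.2) ω - μ.real (C c.1 c.2)
  let y : ((Fin j → Fin (2 ^ ℓ)) × (Fin k → Fin (2 ^ ℓ))) → SeqSpace → ℝ :=
    fun c ω => empFreq N j (A c.1) ω - μ.real (A c.1)
  let z : ((Fin j → Fin (2 ^ ℓ)) × (Fin k → Fin (2 ^ ℓ))) → SeqSpace → ℝ :=
    fun c ω => empFreq N k (B c.2) ω - μ.real (B c.2)
  have hxi c : Integrable (fun ω => x c ω ^ 2) μ := integrable_sq_empFreq_sub (hCm c.1 c.2)
  have hyi c : Integrable (fun ω => y c ω ^ 2) μ := integrable_sq_empFreq_sub (hAm c.1)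
  have hzi c : Integrable (fun ω => z c ω ^ 2) μ := integrable_sq_empFreq_sub (hBm c.2)
  have hx c : ∫ ω, x c ω ^ 2 ∂μ ≤ V :=
    integral_sq_empFreq_sub_le hst hsum (by omega) (hCm c.1 c.2) hN
  have hy c : ∫ ω, y c ω ^ 2 ∂μ ≤ V := integral_sq_empFreq_sub_le hst hsum hj (hAm c.1) hN
  have hz c : ∫ ω, z c ω ^ 2 ∂μ ≤ V :=
    integral_sq_empFreq_sub_le hst hsum (by omega) (hBm c.2) hN
  let g : ((Fin j → Fin (2 ^ ℓ)) × (Fin k → Fin (2 ^ ℓ))) × Fin 3 → SeqSpace → ℝ :=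
    fun c ω => ![|x c.1 ω|, |y c.1 ω|, |z c.1 ω|] c.2
  have hgi c : Integrable (fun ω => g c ω ^ 2) μ := by
    obtain ⟨c, i⟩ := c
    fin_cases i
    · simpa [g] using hxi c
    · simpa [g] using hyi c
    · simpa [g] using hzi c
  have hg c : ∫ ω, g c ω ^ 2 ∂μ ≤ V := by
    obtain ⟨c, i⟩ := c
    fin_cases i
    · simpa [g] using hx c
    · simpa [g] using hy c
    · simpa [g] using hz c
  have hdet (ω : SeqSpace) : 2 * |estDep N n ℓ m j ω -
      discreteDep μ (dyadicCode ℓ 0 j) (dyadicCode ℓ (j + m - 1) k)| ≤ ∑ c, g c ω := by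
    rw [estDep_eq, discreteDep, ← mul_sub, abs_mul, ← Fintype.sum_prod_type',
      ← Fintype.sum_prod_type', ← Finset.sum_sub_distrib, abs_of_pos (by norm_num : (0 : ℝ) < 1 / 2),
      ← mul_assoc, mul_one_div_cancel two_ne_zero, one_mul]
    refine le_trans (Finset.abs_sum_le_sum_abs _ _) ?_
    rw [Fintype.sum_prod_type fun c => g c ω]
    refine Finset.sum_le_sum fun c _ => ?_
    simp only [hB', g, Fin.sum_univ_three]
    exact abs_abs_sub_abs_sub_mul_le measureReal_nonneg measureReal_le_one
      (empFreq_nonneg _ _ _ _) (empFreq_le_one _ _ _ _)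
  -- Here `j + k = n - m + 1 ≤ n` because `m ≥ 1`.
  have hcard : (Fintype.card (((Fin j → Fin (2 ^ ℓ)) × (Fin k → Fin (2 ^ ℓ))) × Fin 3) : ℝ) ≤
      2 ^ (n * ℓ) * 3 := by
    simp only [Fintype.card_prod, Fintype.card_fun, Fintype.card_fin]
    push_cast
    rw [← pow_mul, ← pow_mul, ← pow_add, ← mul_add, mul_comm ℓ]
    gcongr
    · norm_num
    · omega
  have hV0 : 0 ≤ V := by
    have : 0 ≤ ∑' i, betaCoeff μ (i + 1) := tsum_nonneg fun i => betaCoeff_nonneg μ (i + 1)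
    positivity
  calc _ ≤ μ.real {ω | 2 * ε ≤ ∑ c, g c ω} := by
        refine measureReal_mono (fun ω hω => ?_)
        have hω' : ε ≤ _ := hω
        exact (mul_le_mul_of_nonneg_left hω' two_pos.le).trans (hdet ω)
    _ ≤ _ := measureReal_le_sum_le hgi (by positivity) hg
    _ ≤ (2 ^ (n * ℓ) * 3) ^ 2 * V / (2 * ε) ^ 2 := by gcongr
    _ = _ := by ring

end Concentration

/-! ### Approximation by dyadic events -/

/-- The σ-algebra on pairs of sequences generated by the level-`ℓ` digits of the first `j`
coordinates of one sequence and of the coordinates `s, …, s + k - 1` of the other. -/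
@[reducible]
noncomputable def dyadicPairSigma (j s ℓ k : ℕ) : MeasurableSpace (SeqSpace × SeqSpace) :=
  MeasurableSpace.comap (fun w => (dyadicCode ℓ 0 j w.1, dyadicCode ℓ s k w.2)) ⊤

theorem dyadicPairSigma_mono {j s ℓ ℓ' k k' : ℕ} (hℓ : ℓ ≤ ℓ') (hk : k ≤ k') :
    dyadicPairSigma j s ℓ k ≤ dyadicPairSigma j s ℓ' k' := by
  obtain ⟨g, hg⟩ := exists_dyadicCode_factor hℓ (le_refl j) 0
  obtain ⟨h, hh⟩ := exists_dyadicCode_factor hℓ hk s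
  have : (fun w : SeqSpace × SeqSpace => (dyadicCode ℓ 0 j w.1, dyadicCode ℓ s k w.2)) =
      Prod.map g h ∘ fun w => (dyadicCode ℓ' 0 j w.1, dyadicCode ℓ' s k' w.2) := by
    rw [hg, hh]
    rfl
  rw [dyadicPairSigma, this, ← MeasurableSpace.comap_comp]
  exact MeasurableSpace.comap_mono le_top

theorem dyadicPairSigma_le (j s ℓ k : ℕ) :
    dyadicPairSigma j s ℓ k ≤ (inferInstance : MeasurableSpace (SeqSpace × SeqSpace)) := by
  rintro _ ⟨T, -, rfl⟩
  exact (((measurable_dyadicCode ℓ 0 j).comp measurable_fst).prodMk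
    ((measurable_dyadicCode ℓ s k).comp measurable_snd)) T.toFinite.measurableSet

theorem abs_depGap_le_discreteDep {μ : Measure SeqSpace} [IsProbabilityMeasure μ] {j s ℓ k : ℕ}
    {W : Set (SeqSpace × SeqSpace)} (hW : MeasurableSet[dyadicPairSigma j s ℓ k] W) :
    |depGap μ W| ≤ discreteDep μ (dyadicCode ℓ 0 j) (dyadicCode ℓ s k) := by
  obtain ⟨T, -, rfl⟩ := hW
  exact abs_depGap_preimage_le μ (measurable_dyadicCode _ _ _) (measurable_dyadicCode _ _ _) T

/-- A point is the limit of its dyadic approximations, so fine levels suffice. The threshold `ℓ₀` is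
needed below, where the window grows with the level and reaches a given coordinate only from some
level on. -/
theorem measurable_of_measurable_dyadicDigit {Ω : Type*} {m : MeasurableSpace Ω}
    {f : Ω → unitInterval} (ℓ₀ : ℕ) (h : ∀ ℓ, ℓ₀ ≤ ℓ → Measurable fun ω => dyadicDigit ℓ (f ω)) :
    Measurable f := by
  have hreal : Measurable fun ω => (f ω : ℝ) := by
    refine measurable_of_tendsto_metrizable
      (f := fun ℓ ω => (dyadicDigit (ℓ + ℓ₀) (f ω) : ℕ) / (2 : ℝ) ^ (ℓ + ℓ₀)) (fun ℓ => ?_) ?_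
    · have h1 : Measurable fun i : Fin (2 ^ (ℓ + ℓ₀)) => ((i : ℕ) : ℝ) / 2 ^ (ℓ + ℓ₀) :=
        measurable_of_countable _
      exact h1.comp (h (ℓ + ℓ₀) (by omega))
    · rw [tendsto_pi_nhds]
      intro ω
      exact (tendsto_dyadicDigit (f ω)).comp (tendsto_add_atTop_nat ℓ₀)
  exact hreal.subtype_mk

/-- One parameter `p` serves as level and as future window length, so a single increasing sequence
of finite σ-algebras exhausts the infinite future. -/
theorem prod_coordSigma_le_iSup (j m : ℕ) (hj : 1 ≤ j) :
    (coordSigma {s | s + 1 ≤ j}).prod (coordSigma {s | j + m ≤ s + 1}) ≤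
      ⨆ p, dyadicPairSigma j (j + m - 1) p p := by
  have hcomap (p : ℕ) : @Measurable _ _ (⨆ p, dyadicPairSigma j (j + m - 1) p p) ⊤
      fun w : SeqSpace × SeqSpace =>
        (dyadicCode p 0 j w.1, dyadicCode p (j + m - 1) p w.2) :=
    Measurable.mono (comap_measurable _)
      (le_iSup (fun p => dyadicPairSigma j (j + m - 1) p p) p) le_rfl
  refine sup_le ?_ ?_
  · rw [coordSigma, MeasurableSpace.comap_iSup]
    refine iSup_le fun s => ?_
    rw [MeasurableSpace.comap_iSup]
    refine iSup_le fun hs => ?_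
    rw [MeasurableSpace.comap_comp, ← measurable_iff_comap_le]
    have hs' : s + 1 ≤ j := hs
    refine measurable_of_measurable_dyadicDigit 0 fun p _ => ?_
    have := (measurable_from_top (f := fun c : (Fin j → Fin (2 ^ p)) × (Fin p → Fin (2 ^ p)) =>
      c.1 ⟨s, hs'⟩)).comp (hcomap p)
    simpa [dyadicCode, Function.comp_def] using this
  · rw [coordSigma, MeasurableSpace.comap_iSup]
    refine iSup_le fun s => ?_
    rw [MeasurableSpace.comap_iSup]
    refine iSup_le fun hs => ?_
    rw [MeasurableSpace.comap_comp, ← measurable_iff_comap_le]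
    have hs' : j + m ≤ s + 1 := hs
    refine measurable_of_measurable_dyadicDigit (s + 1) fun p hp => ?_
    have := (measurable_from_top (f := fun c : (Fin j → Fin (2 ^ p)) × (Fin p → Fin (2 ^ p)) =>
      c.2 ⟨s - (j + m - 1), by omega⟩)).comp (hcomap p)
    have he : j + m - 1 + (s - (j + m - 1)) = s := by omega
    simpa [dyadicCode, Function.comp_def, he] using this

theorem abs_depGap_le_add (μ : Measure SeqSpace) [IsProbabilityMeasure μ]
    {W W' : Set (SeqSpace × SeqSpace)} (hW : MeasurableSet W) (hW' : MeasurableSet W') :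
    |depGap μ W| ≤ |depGap μ W'| +
      (μ.map (fun ω => (ω, ω)) + μ.prod μ).real (symmDiff W W') := by
  have hd : Measurable fun ω : SeqSpace => (ω, ω) := measurable_id.prodMk measurable_id
  have : IsProbabilityMeasure (μ.map (fun ω : SeqSpace => (ω, ω))) :=
    Measure.isProbabilityMeasure_map hd.aemeasurable
  have hmap {W : Set (SeqSpace × SeqSpace)} (hW : MeasurableSet W) :
      μ.real {ω | (ω, ω) ∈ W} = (μ.map fun ω => (ω, ω)).real W := by
    rw [map_measureReal_apply hd hW]
    rfl
  rw [depGap, depGap, hmap hW, hmap hW', measureReal_add_apply]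
  have h1 := abs_measureReal_sub_le_measureReal_symmDiff
    (μ := μ.map fun ω : SeqSpace => (ω, ω))
    hW.nullMeasurableSet hW'.nullMeasurableSet
  have h2 := abs_measureReal_sub_le_measureReal_symmDiff (μ := μ.prod μ)
    hW.nullMeasurableSet hW'.nullMeasurableSet
  rw [abs_le] at h1 h2
  have h3 := le_abs_self ((μ.map fun ω : SeqSpace => (ω, ω)).real W' - (μ.prod μ).real W')
  have h4 := neg_abs_le ((μ.map fun ω : SeqSpace => (ω, ω)).real W' - (μ.prod μ).real W')
  rw [abs_le]
  constructor <;> linarith [h1.1, h1.2, h2.1, h2.2]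

/-- The union of the increasing `F p` is an algebra generating the supremum, hence dense in measure.
Density is applied to the trimmed measure, since the algebra need not generate `mΩ`. -/
theorem exists_symmDiff_lt_of_iSup {Ω : Type*} {mΩ : MeasurableSpace Ω} (ν : Measure Ω)
    [IsFiniteMeasure ν] {F : ℕ → MeasurableSpace Ω} (hF : Monotone F) (hle : ∀ p, F p ≤ mΩ)
    {W : Set Ω} (hW : MeasurableSet[⨆ p, F p] W) {η : ℝ} (hη : 0 < η) :
    ∃ p W', MeasurableSet[F p] W' ∧ ν.real (symmDiff W W') < η := by
  have hsup : ⨆ p, F p ≤ mΩ := iSup_le hle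
  have halg : IsSetAlgebra {s | ∃ p, MeasurableSet[F p] s} := by
    refine ⟨⟨0, @MeasurableSet.empty _ (F 0)⟩, ?_, ?_⟩
    · rintro s ⟨p, hs⟩
      exact ⟨p, hs.compl⟩
    · rintro s t ⟨p, hs⟩ ⟨q, ht⟩
      exact ⟨max p q, (hF (le_max_left p q) _ hs).union (hF (le_max_right p q) _ ht)⟩
  obtain ⟨W', ⟨p, hp⟩, h⟩ := @Measure.MeasureDense.approx _ (⨆ p, F p) _ _
    (@Measure.MeasureDense.of_generateFrom_isSetAlgebra_finite _ (⨆ p, F p) (ν.trim hsup) _ _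
      halg (MeasurableSpace.measurableSpace_iSup_eq F)) W hW
    (@measure_ne_top _ (⨆ p, F p) _ _ _) η hη
  refine ⟨p, W', hp, ?_⟩
  have hm : MeasurableSet[⨆ p, F p] (symmDiff W W') :=
    @MeasurableSet.symmDiff _ (⨆ p, F p) _ _ hW (le_iSup F p _ hp)
  rw [trim_measurableSet_eq hsup hm] at h
  rw [measureReal_def]
  exact (ENNReal.lt_ofReal_iff_toReal_lt (measure_ne_top _ _)).1 h

/-- Take an event `W` with gap above `c` and a dyadic event closer to it than the excess. The latter
stays dyadic at all finer levels and longer windows, so `p` works for all larger `ℓ` and `k`. -/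
theorem exists_lt_discreteDep {μ : Measure SeqSpace} [IsProbabilityMeasure μ] {m : ℕ} {c : ℝ}
    (hc : c < betaCoeff μ m) :
    ∃ j, 1 ≤ j ∧ ∃ p, ∀ ℓ k, p ≤ ℓ → p ≤ k →
      c < discreteDep μ (dyadicCode ℓ 0 j) (dyadicCode ℓ (j + m - 1) k) := by
  obtain ⟨⟨j, hj⟩, hcj⟩ := exists_lt_of_lt_ciSup hc
  obtain ⟨W, hW, hcW⟩ := exists_lt_abs_depGap μ _ _ hcj
  have hd : Measurable fun ω : SeqSpace => (ω, ω) := measurable_id.prodMk measurable_id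
  have : IsProbabilityMeasure (μ.map (fun ω : SeqSpace => (ω, ω))) :=
    Measure.isProbabilityMeasure_map hd.aemeasurable
  obtain ⟨p, W', hW', hlt⟩ := exists_symmDiff_lt_of_iSup
    (μ.map (fun ω => (ω, ω)) + μ.prod μ) (F := fun p => dyadicPairSigma j (j + m - 1) p p)
    (fun p q hpq => dyadicPairSigma_mono hpq hpq) (fun p => dyadicPairSigma_le _ _ _ _)
    (prod_coordSigma_le_iSup j m hj _ hW) (sub_pos.2 hcW)
  refine ⟨j, hj, p, fun ℓ k hℓ hk => ?_⟩
  have h1 := abs_depGap_le_discreteDep (μ := μ) (dyadicPairSigma_mono hℓ hk _ hW')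
  have h2 := abs_depGap_le_add μ
    (prod_measurableSpace_mono (coordSigma_le _) (coordSigma_le _) _ hW)
    (dyadicPairSigma_le _ _ _ _ _ hW')
  linarith

/-! ### Consistency of the test -/

theorem betaHat_eq (N n ℓ : ℕ) (ω : SeqSpace) (m : ℕ) :
    betaHat N n ℓ ω m = ⨆ j : Finset.Icc 1 (n - m), estDep N n ℓ m j ω := rfl

theorem estDep_le_betaHat {N n ℓ m j : ℕ} (ω : SeqSpace) (hj : 1 ≤ j) (hjn : j + m ≤ n) :
    estDep N n ℓ m j ω ≤ betaHat N n ℓ ω m := by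
  rw [betaHat_eq]
  exact le_ciSup (f := fun j : Finset.Icc 1 (n - m) => estDep N n ℓ m j ω)
    (Set.finite_range _).bddAbove ⟨j, Finset.mem_Icc.2 ⟨hj, by omega⟩⟩

/-- The condition `0 ≤ c` covers `m ≥ n`, where no `j` is admissible and the supremum is `0`. -/
theorem betaHat_le {N n ℓ m : ℕ} {ω : SeqSpace} {c : ℝ} (hc : 0 ≤ c)
    (h : ∀ j, 1 ≤ j → j + m ≤ n → estDep N n ℓ m j ω ≤ c) : betaHat N n ℓ ω m ≤ c := by
  rw [betaHat_eq]
  refine Real.iSup_le (fun j => ?_) hc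
  have := Finset.mem_Icc.1 j.2
  exact h j this.1 (by omega)

theorem measurable_betaHat {S : Set ℕ} {N n m : ℕ} (hm : 1 ≤ m) (hS : ∀ s < N * n, s ∈ S)
    (ℓ : ℕ) : Measurable[coordSigma S] fun ω => betaHat N n ℓ ω m := by
  refine @Measurable.iSup _ _ _ _ _ (coordSigma S) _ _ _ _ _ _ fun j => ?_
  have := Finset.mem_Icc.1 j.2
  exact measurable_estDep hm this.1 (by omega) hS ℓ

theorem measurable_betaTest (γ : ℕ → ℝ) (M ℓ n : ℕ → ℕ) (ε δ : ℕ → ℝ) (t : ℕ) :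
    Measurable[coordSigma {s | s < sampleSize M ℓ n ε δ t}] (betaTest γ M ℓ n ε δ t) := by
  refine @Measurable.ite _ _ (fun _ => 1) (fun _ => -1) (coordSigma {s | s < sampleSize M ℓ n ε δ t}) _ (fun ω =>
    ∀ m ∈ Finset.Icc 1 (M t),
      betaHat (numBlocks m (ℓ t) (n t) (ε t) (δ t)) (n t) (ℓ t) ω m ≤ γ m + ε t)
    (Classical.decPred _) ?_ measurable_const measurable_const
  have h : {ω : SeqSpace | ∀ m ∈ Finset.Icc 1 (M t),
      betaHat (numBlocks m (ℓ t) (n t) (ε t) (δ t)) (n t) (ℓ t) ω m ≤ γ m + ε t} =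
      ⋂ m ∈ Finset.Icc 1 (M t),
        {ω | betaHat (numBlocks m (ℓ t) (n t) (ε t) (δ t)) (n t) (ℓ t) ω m ≤ γ m + ε t} := by
    ext ω
    simp
  rw [h]
  refine @Finset.measurableSet_biInter _ _ (coordSigma {s | s < sampleSize M ℓ n ε δ t}) _ _
    fun m hm => ?_
  refine measurable_betaHat (Finset.mem_Icc.1 hm).1 (fun s hs => ?_) _ measurableSet_Iic
  refine hs.trans_le ?_
  rw [mul_comm]
  exact Nat.mul_le_mul_left _
    (Finset.le_sup (f := fun m => numBlocks m (ℓ t) (n t) (ε t) (δ t)) hm)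

/-- The factor `m` cancels, and of the constant only the part `2 ^ 2 ^ (2 * n * ℓ + 1)` is kept. -/
theorem le_numBlocks {m : ℕ} (hm : 1 ≤ m) (ℓ n : ℕ) {ε δ : ℝ} (hε : 0 < ε) (hδ : 0 < δ) :
    2 ^ 2 ^ (2 * n * ℓ + 1) / (ε ^ 2 * δ) ≤ (numBlocks m ℓ n ε δ : ℝ) := by
  refine le_trans ?_ (Nat.le_ceil _)
  have hm' : (0 : ℝ) < m := by exact_mod_cast hm
  rw [betaConst, mul_assoc (m : ℝ) (ε ^ 2) δ, mul_div_mul_left _ _ hm'.ne']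
  gcongr
  · norm_num
  · exact (Nat.le_add_right _ _).trans (Nat.le_add_right _ _)

/-- The block number must beat `n ^ 2` pairs `(m, j)` and the squared cell count from Chebyshev.
Together they are at most `2 ^ (4 * n * ℓ)`. -/
theorem sq_mul_sq_two_pow_le {n ℓ : ℕ} (hℓ : 0 < ℓ) :
    (n : ℝ) ^ 2 * (2 ^ (n * ℓ)) ^ 2 ≤ 2 ^ 2 ^ (2 * n * ℓ + 1) := by
  have h1 : n ≤ 2 ^ (n * ℓ) :=
    Nat.lt_two_pow_self.le.trans (Nat.pow_le_pow_right two_pos (Nat.le_mul_of_pos_right n hℓ))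
  have h2 : (n : ℝ) ≤ 2 ^ (n * ℓ) := by exact_mod_cast h1
  calc (n : ℝ) ^ 2 * (2 ^ (n * ℓ)) ^ 2 ≤ (2 ^ (n * ℓ)) ^ 2 * (2 ^ (n * ℓ)) ^ 2 := by gcongr
    _ = 2 ^ (4 * (n * ℓ)) := by ring
    _ ≤ 2 ^ 2 ^ (2 * n * ℓ + 1) := by
        gcongr
        · norm_num
        · have := (Nat.lt_two_pow_self (n := 2 * n * ℓ)).le
          rw [pow_succ]
          linarith

section Consistency

variable {μ : Measure SeqSpace} [IsProbabilityMeasure μ]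

theorem discreteDep_le_betaCoeff {m j : ℕ} (hj : 1 ≤ j) (ℓ k : ℕ) :
    discreteDep μ (dyadicCode ℓ 0 j) (dyadicCode ℓ (j + m - 1) k) ≤ betaCoeff μ m := by
  refine (discreteDep_le_betaDep μ (coordSigma_le _) (coordSigma_le _)
    (measurable_dyadicCode_coordSigma fun p hp => ?_)
    (measurable_dyadicCode_coordSigma fun p hp => ?_)).trans (betaDep_le_betaCoeff μ m hj) <;>
  · simp only [Set.mem_ofPred_eq]
    omega

/-- The `ε ^ 2` of Chebyshev cancels against that in the block number, leaving the summable `δ`.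
Uniformity over all `m` costs nothing more, as `j + m ≤ n t` leaves finitely many pairs. -/
theorem ae_eventually_abs_estDep_sub_lt (hst : MeasurePreserving shiftMap μ μ)
    (hsum : Summable fun i : ℕ => betaCoeff μ (i + 1)) {ℓ n : ℕ → ℕ} {ε δ : ℕ → ℝ}
    (hℓ : ∀ t, 0 < ℓ t) (hδ_pos : ∀ t, 0 < δ t) (hδ_sum : Summable δ) (hε_pos : ∀ t, 0 < ε t) :
    ∀ᵐ ω ∂μ, ∀ᶠ t in atTop, ∀ m j, 1 ≤ m → 1 ≤ j → j + m ≤ n t →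
      |estDep (numBlocks m (ℓ t) (n t) (ε t) (δ t)) (n t) (ℓ t) m j ω -
        discreteDep μ (dyadicCode (ℓ t) 0 j) (dyadicCode (ℓ t) (j + m - 1) (n t - m - j + 1))| <
      ε t := by
  set S := ∑' i, betaCoeff μ (i + 1) with hS
  have hS0 : 0 ≤ S := tsum_nonneg fun i => betaCoeff_nonneg μ (i + 1)
  let E : ℕ → ℕ × ℕ → Set SeqSpace := fun t c => {ω | ε t ≤
    |estDep (numBlocks c.1 (ℓ t) (n t) (ε t) (δ t)) (n t) (ℓ t) c.1 c.2 ω -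
      discreteDep μ (dyadicCode (ℓ t) 0 c.2)
        (dyadicCode (ℓ t) (c.2 + c.1 - 1) (n t - c.1 - c.2 + 1))|}
  let I : ℕ → Finset (ℕ × ℕ) := fun t =>
    (Finset.Icc 1 (n t) ×ˢ Finset.Icc 1 (n t)).filter fun c => c.2 + c.1 ≤ n t
  have hI (t : ℕ) : ((I t).card : ℝ) ≤ (n t : ℝ) ^ 2 := by
    have h : (I t).card ≤ n t * n t := by
      refine (Finset.card_filter_le _ _).trans ?_
      simp
    rw [sq]
    exact_mod_cast h
  have hE (t : ℕ) (c) (hc : c ∈ I t) : μ.real (E t c) ≤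
      (2 ^ (n t * ℓ t)) ^ 2 / 2 ^ 2 ^ (2 * n t * ℓ t + 1) * (9 * (1 + 2 * S) * δ t) := by
    simp only [I, Finset.mem_filter, Finset.mem_product, Finset.mem_Icc] at hc
    have hN := le_numBlocks hc.1.1.1 (ℓ t) (n t) (hε_pos t) (hδ_pos t)
    have hε := hε_pos t
    have hδ := hδ_pos t
    have hN0 : (0 : ℝ) < numBlocks c.1 (ℓ t) (n t) (ε t) (δ t) := lt_of_lt_of_le (by positivity) hN
    refine (measureReal_estDep_sub_ge_le hst hsum hc.1.1.1 hc.1.2.1 hc.2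
      (by exact_mod_cast hN0) (ℓ t) (hε_pos t)).trans ?_
    calc _ ≤ (2 ^ (n t * ℓ t)) ^ 2 * (9 * ((1 + 2 * S) /
          (2 ^ 2 ^ (2 * n t * ℓ t + 1) / (ε t ^ 2 * δ t)))) / (ε t) ^ 2 := by
          gcongr
          linarith
      _ = _ := by field_simp
  have hbound (t : ℕ) : μ.real (⋃ c ∈ I t, E t c) ≤ 9 * (1 + 2 * S) * δ t := by
    have hδ := hδ_pos t
    calc _ ≤ ∑ c ∈ I t, μ.real (E t c) := measureReal_biUnion_finset_le _ _
      _ ≤ (I t).card •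
          ((2 ^ (n t * ℓ t)) ^ 2 / 2 ^ 2 ^ (2 * n t * ℓ t + 1) * (9 * (1 + 2 * S) * δ t)) :=
          Finset.sum_le_card_nsmul _ _ _ (hE t)
      _ ≤ (n t : ℝ) ^ 2 *
          ((2 ^ (n t * ℓ t)) ^ 2 / 2 ^ 2 ^ (2 * n t * ℓ t + 1) * (9 * (1 + 2 * S) * δ t)) := by
          rw [nsmul_eq_mul]
          gcongr
          exact hI t
      _ = ((n t : ℝ) ^ 2 * (2 ^ (n t * ℓ t)) ^ 2) / 2 ^ 2 ^ (2 * n t * ℓ t + 1) *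
          (9 * (1 + 2 * S) * δ t) := by ring
      _ ≤ 1 * (9 * (1 + 2 * S) * δ t) := by
          gcongr
          exact div_le_one_of_le₀ (sq_mul_sq_two_pow_le (hℓ t)) (by positivity)
      _ = _ := one_mul _
  have hfin : ∑' t, μ (⋃ c ∈ I t, E t c) ≠ ⊤ := by
    have h1 : Summable fun t => 9 * (1 + 2 * S) * δ t := hδ_sum.mul_left _
    refine ne_top_of_le_ne_top h1.tsum_ofReal_ne_top (ENNReal.tsum_le_tsum fun t => ?_)
    rw [← ofReal_measureReal (h := measure_ne_top _ _)]
    exact ENNReal.ofReal_le_ofReal (hbound t)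
  filter_upwards [ae_eventually_notMem hfin] with ω hω
  filter_upwards [hω] with t ht m j hm hj hjn
  by_contra hlt
  refine ht (Set.mem_biUnion (x := (m, j)) ?_ (not_lt.1 hlt))
  simp only [I, Finset.coe_filter, Finset.mem_product, Finset.mem_Icc, Set.mem_ofPred_eq]
  omega

end Consistency

theorem mainTheorem10
    (γ : ℕ → ℝ) (hγ : ∀ m, 1 ≤ m → γ m ∈ Set.Icc (0 : ℝ) 1)
    (M ℓ n : ℕ → ℕ)
    (hM_pos : ∀ t, 0 < M t) (hM_mono : Monotone M) (hM_lim : Tendsto M atTop atTop)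
    (hℓ_pos : ∀ t, 0 < ℓ t) (hℓ_mono : Monotone ℓ) (hℓ_lim : Tendsto ℓ atTop atTop)
    (hn_pos : ∀ t, 0 < n t) (hn_mono : Monotone n) (hn_lim : Tendsto n atTop atTop)
    (δ : ℕ → ℝ) (hδ_pos : ∀ t, 0 < δ t) (hδ_sum : Summable δ)
    (ε : ℕ → ℝ) (hε_pos : ∀ t, 0 < ε t) (hε_lim : Tendsto ε atTop (𝓝 0)) :
    -- the test at stage `t` is a measurable function of the first `sampleSize` observations
    (∀ t, Measurable[coordSigma {s | s < sampleSize M ℓ n ε δ t}] (betaTest γ M ℓ n ε δ t)) ∧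
    -- strong consistency under the null hypothesis and under the alternative
    ∀ μ : Measure SeqSpace, InClassBeta μ →
      (IsBetaRate γ μ →
        ∀ᵐ ω ∂μ, Tendsto (fun t => betaTest γ M ℓ n ε δ t ω) atTop (𝓝 1)) ∧
      (¬ IsBetaRate γ μ →
        ∀ᵐ ω ∂μ, Tendsto (fun t => betaTest γ M ℓ n ε δ t ω) atTop (𝓝 (-1))) := by
  refine ⟨measurable_betaTest γ M ℓ n ε δ, fun μ hμ => ?_⟩
  have := hμ.prob
  have hconc := ae_eventually_abs_estDep_sub_lt hμ.stationary hμ.summable (n := n)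
    hℓ_pos hδ_pos hδ_sum hε_pos
  constructor
  · intro hrate
    filter_upwards [hconc] with ω hω
    refine tendsto_const_nhds.congr' ?_
    filter_upwards [hω] with t ht
    refine (if_pos fun m hm => ?_).symm
    have hm1 := (Finset.mem_Icc.1 hm).1
    -- `γ m ≥ 0` settles the indices `m ≥ n t`, where the estimate is `0`.
    refine betaHat_le (by linarith [(hγ m hm1).1, hε_pos t]) fun j hj hjn => ?_
    have h1 := (abs_lt.1 (ht m j hm1 hj hjn)).2
    have h2 := discreteDep_le_betaCoeff (μ := μ) (m := m) hj (ℓ t) (n t - m - j + 1)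
    linarith [hrate m hm1]
  · intro hrate
    simp only [IsBetaRate, not_forall, not_le] at hrate
    obtain ⟨m, hm, hlt⟩ := hrate
    obtain ⟨c, hγc, hcβ⟩ := exists_between hlt
    obtain ⟨j, hj, p, hp⟩ := exists_lt_discreteDep hcβ
    filter_upwards [hconc] with ω hω
    refine tendsto_const_nhds.congr' ?_
    -- `n t ≥ p + m + j` makes the future window at least `p` long, and `ε t < (c - γ m) / 2` gives
    -- `c - ε t > γ m + ε t`.
    filter_upwards [hω, hM_lim.eventually_ge_atTop m, hℓ_lim.eventually_ge_atTop p,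
      hn_lim.eventually_ge_atTop (p + m + j),
      hε_lim.eventually_lt_const (half_pos (sub_pos.2 hγc))] with t ht hMt hℓt hnt hεt
    refine (if_neg fun hall => ?_).symm
    have h1 := hall m (Finset.mem_Icc.2 ⟨hm, hMt⟩)
    have h2 := (abs_lt.1 (ht m j hm hj (by omega))).1
    have h3 := hp (ℓ t) (n t - m - j + 1) hℓt (by omega)
    have h4 := estDep_le_betaHat (N := numBlocks m (ℓ t) (n t) (ε t) (δ t)) (ℓ := ℓ t) ω hj
      (show j + m ≤ n t by omega)
    linarith
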